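/- Let $\mathcal M=M_m(\mathbb C)$ be the algebra of complex $m\times m$ matrices with the norm of the Hermitian product $(A,B)\mapsto \operatorname{tr}(AB^*)$, let $S^1=\mathbb R/\mathbb Z$, and let $N\subset\mathcal M$ be a connected smooth finite-dimensional manifold (without boundary) smoothly embedded in $\mathcal M$, with a base point $x_0\in N$. For $s\ge 0$ let $H^s(S^1,\mathcal M)$ be the space of $f\in L^2(S^1,\mathcal M)$ with $$\|f\|_s^2=\sum_{n\in\mathbb Z}(1+|n|)^{2s}\|f_n\|^2<\infty,$$ where $f_n$ are the Fourier coefficients of $f$, with the topology of the norm $\|\cdot\|_s$. Let $H^s_0(S^1,N)$ be the closure in $H^s(S^1,\mathcal M)$ of the set of smooth loops $\gamma:S^1\to N$ with $\gamma(0)=x_0$, and let $L^2(S^1,N)$ be the closure in $L^2(S^1,\mathcal M)$ of the set of all smooth loops $\gamma: S^1\to N$. Let $k>1/2$ and let $i:H^k_0(S^1,N)\to L^2(S^1,N)$ be the canonical inclusion. Then: 1. for every abelian group $A$ of coefficients, $i$ induces the zero map $i_*:\tilde H_n(H^k_0(S^1,N);A)\to\tilde H_n(L^2(S^1,N);A)$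 on reduced singular homology for all $n\ge 0$ (where $\tilde H_n(X;A)=\ker(H_n(X;A)\to H_n(\mathrm{pt};A))$), and hence the zero map on singular homology $H_n(\,\cdot\,;A)$ for all $n\ge 1$; 2. for every $n\ge 0$ and every base point $\gamma\in H^k_0(S^1,N)$, the induced map $i_*:\pi_n(H^k_0(S^1,N),\gamma)\to\pi_n(L^2(S^1,N),i(\gamma))$ is trivial, that is, it sends every element to the class of the constant map. -/

import Mathlib

open MeasureTheory CategoryTheory
open scoped ENNReal Manifold ContDiff Topology

noncomputable section

/-! ### Matrices with the Frobenius norm, and the Sobolev spaces of matrix-valued loops -/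

/-- The algebra of complex `m × m` matrices, with the norm of the Hermitian product
`(A, B) ↦ tr (A B*)`, that is, the Frobenius norm. -/
def MatC (m : ℕ) : Type := Matrix (Fin m) (Fin m) ℂ

instance MatC.instNormedAddCommGroup (m : ℕ) : NormedAddCommGroup (MatC m) :=
  (Matrix.frobeniusNormedAddCommGroup : NormedAddCommGroup (Matrix (Fin m) (Fin m) ℂ))

instance MatC.instNormedSpace (m : ℕ) : NormedSpace ℂ (MatC m) :=
  letI : NormedAddCommGroup (Matrix (Fin m) (Fin m) ℂ) := Matrix.frobeniusNormedAddCommGroup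
  (Matrix.frobeniusNormedSpace : NormedSpace ℂ (Matrix (Fin m) (Fin m) ℂ))

instance MatC.instFiniteDimensional (m : ℕ) : FiniteDimensional ℂ (MatC m) :=
  inferInstanceAs (FiniteDimensional ℂ (Matrix (Fin m) (Fin m) ℂ))

/-- The entry `A ↦ A_ij` as a continuous linear map. -/
def MatC.entry {m : ℕ} (i j : Fin m) : MatC m →L[ℂ] ℂ :=
  LinearMap.toContinuousLinearMap
    { toFun := fun A => A i j, map_add' := fun _ _ => rfl, map_smul' := fun _ _ => rfl }

/-- The square of the norm is `∑ |A_ij|² = tr (A A*)`. -/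
lemma MatC.norm_sq {m : ℕ} (A : MatC m) : ‖A‖ ^ 2 = ∑ i, ∑ j, ‖MatC.entry i j A‖ ^ 2 := by
  have h : ‖A‖ = (∑ i, ∑ j, ‖A i j‖ ^ (2 : ℝ)) ^ (1 / 2 : ℝ) := Matrix.frobenius_norm_def A
  rw [h, ← Real.sqrt_eq_rpow, Real.sq_sqrt (by positivity)]
  simp only [Real.rpow_ofNat]
  rfl

/-- The circle `S¹ = ℝ / ℤ`. -/
abbrev S1 : Type := UnitAddCircle

/-- The normalised Haar (= Lebesgue) measure of `S¹ = ℝ / ℤ`. -/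
abbrev circleMeasure : Measure S1 := AddCircle.haarAddCircle

/-- The Hilbert space `L²(S¹, M)` of classes of square integrable matrix-valued functions. -/
abbrev L2Circle (m : ℕ) : Type := Lp (MatC m) 2 circleMeasure

/-- The sequence `n ↦ (1 + |n|)^s f_n`, where `f_n` are the (matrix-valued) Fourier coefficients. -/
def weightedCoeff {m : ℕ} (s : ℝ) (f : L2Circle m) (n : ℤ) : MatC m :=
  ((1 + |(n : ℝ)|) ^ s : ℝ) • fourierCoeff (f : S1 → MatC m) n

/-- For `s ≥ 0`, the Sobolev space `H^s(S¹, M)`: the functions `f ∈ L²(S¹, M)` such that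
`‖f‖_s² = ∑ (1 + |n|)^(2 s) ‖f_n‖²` is finite. -/
def SobolevCircle (m : ℕ) (s : ℝ) : Type :=
  {f : L2Circle m // Memℓp (weightedCoeff s f) 2}

/-- The function `f ∈ H^s(S¹, M)` as the `ℓ²` sequence `(1 + |n|)^s f_n`, whose `ℓ²` norm is
`‖f‖_s`. -/
def SobolevCircle.toSeq {m : ℕ} {s : ℝ} (f : SobolevCircle m s) : lp (fun _ : ℤ => MatC m) 2 :=
  ⟨weightedCoeff s f.1, f.2⟩

/-- The distance of `H^s(S¹, M)` is the distance `‖f - g‖_s` of the Sobolev norm. -/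
instance SobolevCircle.instPseudoMetricSpace (m : ℕ) (s : ℝ) :
    PseudoMetricSpace (SobolevCircle m s) :=
  PseudoMetricSpace.induced SobolevCircle.toSeq inferInstance

lemma weightedCoeff_sub {m : ℕ} (s : ℝ) (f g : L2Circle m) (n : ℤ) :
    weightedCoeff s f n - weightedCoeff s g n = weightedCoeff s (f - g) n := by
  have hf : Integrable (fun t : S1 => fourier (-n) t • (f : S1 → MatC m) t) circleMeasure :=
    ((Lp.memLp f).integrable (by norm_num)).fourier_smul (-n)
  have hg : Integrable (fun t : S1 => fourier (-n) t • (g : S1 → MatC m) t) circleMeasure :=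
    ((Lp.memLp g).integrable (by norm_num)).fourier_smul (-n)
  rw [weightedCoeff, weightedCoeff, weightedCoeff, ← smul_sub,
    fourierCoeff_congr_ae (Lp.coeFn_sub f g)]
  congr 1
  simp only [fourierCoeff, Pi.sub_apply, smul_sub]
  exact (integral_sub hf hg).symm

/-- The square of the distance of `H^s(S¹, M)` is `∑ (1 + |n|)^(2 s) ‖(f - g)_n‖²`. -/
lemma SobolevCircle.hasSum_dist_sq {m : ℕ} {s : ℝ} (f g : SobolevCircle m s) :
    HasSum (fun n : ℤ => (1 + |(n : ℝ)|) ^ (2 * s) *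
      ‖fourierCoeff ((f.1 - g.1 : L2Circle m) : S1 → MatC m) n‖ ^ 2) (dist f g ^ 2) := by
  have h := lp.hasSum_norm (p := 2) (by norm_num) (f.toSeq - g.toSeq)
  have hd : dist f g = ‖f.toSeq - g.toSeq‖ := dist_eq_norm f.toSeq g.toSeq
  rw [hd]
  simp only [ENNReal.toReal_ofNat, Real.rpow_ofNat] at h
  convert h using 2 with n
  change _ = ‖weightedCoeff s f.1 n - weightedCoeff s g.1 n‖ ^ 2
  have h0 : (0 : ℝ) ≤ 1 + |(n : ℝ)| := by positivity
  rw [weightedCoeff_sub, weightedCoeff, norm_smul, mul_pow, Real.norm_eq_abs, sq_abs,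
    mul_comm 2 s, Real.rpow_mul h0, Real.rpow_ofNat]

/-- Parseval's identity for matrix-valued functions. -/
lemma hasSum_sq_fourierCoeff_matC {m : ℕ} (h : L2Circle m) :
    HasSum (fun n : ℤ => ‖fourierCoeff (h : S1 → MatC m) n‖ ^ 2) (‖h‖ ^ 2) := by
  have hL : ∀ i j : Fin m, ∀ n : ℤ, fourierCoeff ((MatC.entry i j).compLp h : S1 → ℂ) n =
      MatC.entry i j (fourierCoeff (h : S1 → MatC m) n) := by
    intro i j n
    rw [fourierCoeff_congr_ae ((MatC.entry i j).coeFn_compLp h)]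
    simp only [fourierCoeff]
    rw [← ContinuousLinearMap.integral_comp_comm _
      (((Lp.memLp h).integrable (by norm_num)).fourier_smul (-n))]
    simp only [map_smul]
  have hN : ‖h‖ ^ 2 = ∫ t, ‖(h : S1 → MatC m) t‖ ^ 2 ∂circleMeasure := by
    rw [Lp.norm_def, MemLp.eLpNorm_eq_integral_rpow_norm (by norm_num) (by norm_num) (Lp.memLp h),
      ENNReal.toReal_ofReal (by positivity)]
    simp only [ENNReal.toReal_ofNat, Real.rpow_ofNat]
    rw [show (2⁻¹ : ℝ) = 1 / 2 by norm_num, ← Real.sqrt_eq_rpow, Real.sq_sqrt (by positivity)]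
  have hI : ∀ i j : Fin m, Integrable
      (fun t => ‖MatC.entry i j ((h : S1 → MatC m) t)‖ ^ 2) circleMeasure := by
    intro i j
    exact ((MatC.entry i j).comp_memLp' (Lp.memLp h)).integrable_norm_pow (by norm_num)
  have hS : ‖h‖ ^ 2 =
      ∑ i, ∑ j, ∫ t, ‖((MatC.entry i j).compLp h : S1 → ℂ) t‖ ^ 2 ∂circleMeasure := by
    rw [hN]
    simp only [MatC.norm_sq]
    rw [integral_finsetSum _ fun i _ => integrable_finsetSum _ fun j _ => hI i j]
    refine Finset.sum_congr rfl fun i _ => ?_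
    rw [integral_finsetSum _ fun j _ => hI i j]
    refine Finset.sum_congr rfl fun j _ => integral_congr_ae ?_
    filter_upwards [(MatC.entry i j).coeFn_compLp h] with t ht
    rw [ht]
  rw [hS]
  simp only [MatC.norm_sq, ← hL]
  exact hasSum_sum fun i _ => hasSum_sum fun j _ => hasSum_sq_fourierCoeff _

/-- The inclusion `H^s(S¹, M) → L²(S¹, M)` is continuous for `s ≥ 0`. -/
lemma SobolevCircle.continuous_val {m : ℕ} {s : ℝ} (hs : 0 ≤ s) :
    Continuous (fun f : SobolevCircle m s => f.1) := by
  refine (LipschitzWith.of_dist_le_mul (K := 1) fun f g => ?_).continuous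
  rw [NNReal.coe_one, one_mul, dist_eq_norm]
  refine le_of_sq_le_sq ?_ dist_nonneg
  refine hasSum_le (fun n => ?_) (hasSum_sq_fourierCoeff_matC (f.1 - g.1))
    (SobolevCircle.hasSum_dist_sq f g)
  exact le_mul_of_one_le_left (sq_nonneg _)
    (Real.one_le_rpow (by linarith [abs_nonneg (n : ℝ)]) (by linarith))

/-! ### Loop spaces of an embedded manifold -/

section LoopSpaces

variable {m : ℕ} (d : ℕ) {N : Type*} [TopologicalSpace N]
  [ChartedSpace (EuclideanSpace ℝ (Fin d)) N]

/-- `f ∈ C^∞(S¹, N)`: the `1`-periodic function `t ↦ f (t mod 1)` on `ℝ` is smooth. -/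
def IsSmoothLoop (f : S1 → N) : Prop :=
  ContMDiff 𝓘(ℝ, ℝ) (𝓡 d) ∞ (fun t : ℝ => f (t : S1))

/-- `H^s_0(S¹, N)`: the closure in `H^s(S¹, M)` of the set of smooth loops in `N ⊆ M` (via the
embedding `e`) with `γ(0) = x₀`. -/
def basedSobolevLoops (s : ℝ) (e : N → MatC m) (x₀ : N) : Set (SobolevCircle m s) :=
  closure {u | ∃ f : S1 → N, IsSmoothLoop d f ∧ f 0 = x₀ ∧ u.1 =ᵐ[circleMeasure] e ∘ f}

/-- `L²(S¹, N)`: the closure in `L²(S¹, M)` of the set of smooth loops in `N ⊆ M` (via the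
embedding `e`). -/
def l2Loops (e : N → MatC m) : Set (L2Circle m) :=
  closure {u | ∃ f : S1 → N, IsSmoothLoop d f ∧ u =ᵐ[circleMeasure] e ∘ f}

/-- The canonical inclusion `H^s_0(S¹, N) → L²(S¹, N)`, for `s > 1/2`. -/
def loopInclusion {s : ℝ} (hs : 1 / 2 < s) (e : N → MatC m) (x₀ : N) :
    C(basedSobolevLoops d s e x₀, l2Loops d e) where
  toFun γ := ⟨γ.1.1, map_mem_closure (SobolevCircle.continuous_val (by linarith)) γ.2
    (fun _ ⟨f, hf, _, hu⟩ => ⟨f, hf, hu⟩)⟩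
  continuous_toFun :=
    ((SobolevCircle.continuous_val (by linarith)).comp continuous_subtype_val).subtype_mk _

end LoopSpaces

/-! ### Homotopy groups and singular homology -/

/-- The map `f_* : π_n(X, x) → π_n(Y, f x)` induced by a continuous map `f : X → Y`. -/
def homotopyGroupMap {X Y : Type*} [TopologicalSpace X] [TopologicalSpace Y] (n : ℕ)
    (f : C(X, Y)) (x : X) : π_ n X x → π_ n Y (f x) :=
  Quotient.map (fun p => ⟨f.comp p.1, fun y hy => congrArg f (p.2 y hy)⟩)
    (fun _ _ h => h.map fun H => H.compContinuousMap f)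

/-- The neutral element (for `n = 0`, the base point) of `π_n(X, x)`: the class of the constant
map. -/
def homotopyGroupBase {X : Type*} [TopologicalSpace X] (n : ℕ) (x : X) : π_ n X x :=
  Quotient.mk _ GenLoop.const

/-- The singular homology group `H_n(X; A)`. -/
abbrev singularH (A : AddCommGrpCat.{0}) (n : ℕ) : TopCat.{0} ⥤ AddCommGrpCat.{0} :=
  (AlgebraicTopology.singularHomologyFunctor AddCommGrpCat.{0} n).obj A

/-- The map of a space to the one-point space. -/
def toPoint (X : TopCat.{0}) : X ⟶ TopCat.of PUnit.{1} :=
  TopCat.ofHom (ContinuousMap.const X PUnit.unit)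

/-- The reduced singular homology group: the kernel of `H_n(X; A) → H_n(pt; A)`. -/
def reducedSingularH (A : AddCommGrpCat.{0}) (n : ℕ) (X : TopCat.{0}) : AddCommGrpCat.{0} :=
  Limits.kernel ((singularH A n).map (toPoint X))

/-- The map of reduced singular homology groups induced by a continuous map. -/
def reducedSingularHMap (A : AddCommGrpCat.{0}) (n : ℕ) {X Y : TopCat.{0}} (f : X ⟶ Y) :
    reducedSingularH A n X ⟶ reducedSingularH A n Y :=
  Limits.kernel.map _ _ ((singularH A n).map f) (𝟙 _) (by
    rw [Category.comp_id, ← Functor.map_comp]; rfl)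

end

/-! Jumps cost nothing in $L^2$. For $u, v \in L^2(S^1,N)$ let `splice s u v` be $u$ on $[0,s)$ and
$v$ on $[s,1)$. It is continuous in $(s,u,v)$, and as $s$ runs from $1$ to $0$ it deforms every $u$
to $v$ while keeping $v$ fixed. So $L^2(S^1,N)$ contracts to each of its points relative to that
point, and every map into it is nullhomotopic, in the based sense needed for $\pi_n$.

What needs proof is that splices stay in the closure of the smooth loops (`splice_mem_l2Loops`). By
continuity it is enough to splice smooth loops. The result is bounded and continuous almost
everywhere, hence an almost everywhere limit of step functions (`mem_l2Loops_of_ae_continuousAt`). A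
step function is in turn a limit of smooth loops that follow smooth paths of the connected manifold
$N$ from one value to the next in ever shorter time (`mem_l2Loops_of_step`). Dominated convergence
turns both limits into $L^2$ limits. -/

/-! ### Smooth paths and smooth loops with prescribed values -/

/-- The map running through the paths `c j`, `j ∈ ℤ`, on the intervals `[j / n, (j + 1) / n)`,
with speed `n K`. -/
noncomputable def pathChain {X : Type*} (n : ℕ) (K : ℝ) (c : ℤ → ℝ → X) (t : ℝ) : X :=
  c ⌊n * t⌋ (K * Int.fract (n * t))

lemma periodic_pathChain {X : Type*} (n : ℕ) (K : ℝ) {c : ℤ → ℝ → X} (hc : ∀ j, c (j + n) = c j) :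
    Function.Periodic (pathChain n K c) 1 := by
  intro t
  have h : (n : ℝ) * (t + 1) = n * t + (n : ℤ) := by push_cast; ring
  rw [pathChain, pathChain, h, Int.floor_add_intCast, Int.fract_add_intCast, hc]

section SmoothPaths

variable {d : ℕ} {N : Type*} [TopologicalSpace N] [ChartedSpace (EuclideanSpace ℝ (Fin d)) N]

/-- `c` is a smooth path from `x` to `y`, constant before time `0` and after time `1`. -/
structure IsSmoothPath (d : ℕ) {N : Type*} [TopologicalSpace N]
    [ChartedSpace (EuclideanSpace ℝ (Fin d)) N] (x y : N) (c : ℝ → N) : Prop where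
  contMDiff : ContMDiff 𝓘(ℝ, ℝ) (𝓡 d) ∞ c
  eq_left : ∀ t ≤ 0, c t = x
  eq_right : ∀ t, 1 ≤ t → c t = y

lemma IsSmoothPath.reverse {x y : N} {c : ℝ → N} (hc : IsSmoothPath d x y c) :
    IsSmoothPath d y x (fun t => c (1 - t)) where
  contMDiff := hc.contMDiff.comp (contDiff_const.sub contDiff_id).contMDiff
  eq_left t ht := hc.eq_right _ (by linarith)
  eq_right t ht := hc.eq_left _ (by linarith)

/-- The first path ends at time $1/4$ and the second starts at $3/4$; the map rests at $y$ in
between, so the gluing at $1/2$ is smooth. -/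
lemma IsSmoothPath.trans {x y z : N} {c c' : ℝ → N} (hc : IsSmoothPath d x y c)
    (hc' : IsSmoothPath d y z c') :
    IsSmoothPath d x z (fun t => if t < 1 / 2 then c (4 * t) else c' (4 * t - 3)) where
  contMDiff t := by
    rcases lt_or_ge t (1 / 2) with ht | ht
    · have h : ContMDiff 𝓘(ℝ, ℝ) (𝓡 d) ∞ (fun t : ℝ => c (4 * t)) :=
        hc.contMDiff.comp (contDiff_const.mul contDiff_id).contMDiff
      refine (h t).congr_of_eventuallyEq ?_
      filter_upwards [Iio_mem_nhds ht] with s hs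
      exact if_pos hs
    · have h : ContMDiff 𝓘(ℝ, ℝ) (𝓡 d) ∞ (fun t : ℝ => c' (4 * t - 3)) :=
        hc'.contMDiff.comp ((contDiff_const.mul contDiff_id).sub contDiff_const).contMDiff
      refine (h t).congr_of_eventuallyEq ?_
      filter_upwards [Ioi_mem_nhds (show 1 / 4 < t by linarith)] with s hs
      rw [Set.mem_Ioi] at hs
      split_ifs with h2
      · rw [hc.eq_right _ (by linarith), hc'.eq_left _ (by linarith)]
      · rfl
  eq_left t ht := by
    rw [if_pos (by linarith), hc.eq_left _ (by linarith)]
  eq_right t ht := by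
    rw [if_neg (by linarith), hc'.eq_right _ (by linarith)]

/-- In a chart, follow the straight segment inside a ball, with a smooth time change that is
constant outside $[0,1]$. -/
lemma eventually_exists_isSmoothPath [IsManifold (𝓡 d) ∞ N] (x : N) :
    ∀ᶠ y in 𝓝 x, ∃ c : ℝ → N, IsSmoothPath d x y c := by
  obtain ⟨r, hr, hball⟩ := Metric.mem_nhds_iff.1 (extChartAt_target_mem_nhds (I := 𝓡 d) x)
  filter_upwards [extChartAt_source_mem_nhds (I := 𝓡 d) x,
    (continuousAt_extChartAt (I := 𝓡 d) x).preimage_mem_nhds (Metric.ball_mem_nhds _ hr)]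
    with y hy hyr
  set φ := extChartAt (𝓡 d) x
  have hmem : ∀ t : ℝ, AffineMap.lineMap (φ x) (φ y) (Real.smoothTransition t) ∈ φ.target :=
    fun t => hball ((convex_ball (φ x) r).lineMap_mem (Metric.mem_ball_self hr) hyr
      ⟨Real.smoothTransition.nonneg t, Real.smoothTransition.le_one t⟩)
  refine ⟨fun t => φ.symm (AffineMap.lineMap (φ x) (φ y) (Real.smoothTransition t)), ?_, ?_, ?_⟩
  · refine (contMDiffOn_extChartAt_symm x).comp_contMDiff ?_ hmem
    refine ContDiff.contMDiff ?_
    simp only [AffineMap.lineMap_apply_module']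
    exact (Real.smoothTransition.contDiff.smul contDiff_const).add contDiff_const
  · intro t ht
    simp only [Real.smoothTransition.zero_of_nonpos ht, AffineMap.lineMap_apply_zero]
    exact extChartAt_to_inv x
  · intro t ht
    simp only [Real.smoothTransition.one_of_one_le ht, AffineMap.lineMap_apply_one]
    exact φ.left_inv hy

/-- Any two points of a connected manifold are joined by a smooth path. -/
lemma exists_isSmoothPath [IsManifold (𝓡 d) ∞ N] [ConnectedSpace N] (x y : N) :
    ∃ c : ℝ → N, IsSmoothPath d x y c :=
  have : Std.Symm fun x y : N => ∃ c : ℝ → N, IsSmoothPath d x y c :=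
    ⟨fun _ _ ⟨_, h⟩ => ⟨_, h.reverse⟩⟩
  PreconnectedSpace.induction₂ (fun x y => ∃ c : ℝ → N, IsSmoothPath d x y c)
    eventually_exists_isSmoothPath ⟨fun _ _ _ ⟨_, h⟩ ⟨_, h'⟩ => ⟨_, h.trans h'⟩⟩ x y

lemma IsSmoothPath.isCompact_range {x y : N} {c : ℝ → N} (hc : IsSmoothPath d x y c) :
    IsCompact (Set.range c) := by
  have h : Set.range c = c '' Set.Icc 0 1 := by
    refine (Set.image_subset_range _ _).antisymm' ?_
    rintro _ ⟨t, rfl⟩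
    rcases le_total t 0 with h0 | h0
    · exact ⟨0, by simp, by rw [hc.eq_left _ h0, hc.eq_left _ le_rfl]⟩
    rcases le_total t 1 with h1 | h1
    · exact ⟨t, ⟨h0, h1⟩, rfl⟩
    · exact ⟨1, by simp, by rw [hc.eq_right _ h1, hc.eq_right _ le_rfl]⟩
  rw [h]
  exact isCompact_Icc.image hc.contMDiff.continuous

lemma contMDiff_pathChain {n : ℕ} {K : ℝ} (hK : 2 ≤ K) {x : ℤ → N}
    {c : ℤ → ℝ → N} (hc : ∀ j, IsSmoothPath d (x (j - 1)) (x j) (c j)) :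
    ContMDiff 𝓘(ℝ, ℝ) (𝓡 d) ∞ (pathChain n K c) := by
  intro t
  set j := ⌊n * t⌋ with hj
  have h : ContMDiff 𝓘(ℝ, ℝ) (𝓡 d) ∞ (fun t : ℝ => c j (K * (n * t - j))) :=
    (hc j).contMDiff.comp
      (contDiff_const.mul ((contDiff_const.mul contDiff_id).sub contDiff_const)).contMDiff
  refine (h t).congr_of_eventuallyEq ?_
  have hcont : ContinuousAt (fun t : ℝ => n * t) t := by fun_prop
  -- As $K \ge 2$, each path has arrived by the middle of its interval. On the half interval before
  -- $j/n$ the piece $j-1$ thus rests at `x (j - 1)`, as does piece $j$ extended to the left, so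
  -- piece $j$ alone describes the map near $t$.
  filter_upwards [hcont.preimage_mem_nhds (Ioo_mem_nhds
    (show (j : ℝ) - 1 / 2 < n * t by linarith [Int.floor_le (n * t : ℝ)])
    (Int.lt_floor_add_one (n * t : ℝ)))] with s hs
  obtain ⟨hs1, hs2⟩ := hs
  rw [pathChain, Int.fract]
  rcases lt_or_ge (n * s) (j : ℝ) with h3 | h3
  · have hfl : ⌊n * s⌋ = j - 1 := by
      rw [Int.floor_eq_iff]; push_cast; constructor <;> linarith
    rw [hfl, (hc _).eq_right, (hc _).eq_left]
    · exact mul_nonpos_of_nonneg_of_nonpos (by linarith) (by linarith)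
    · push_cast; nlinarith
  · have hfl : ⌊n * s⌋ = j := Int.floor_eq_iff.2 ⟨h3, hs2⟩
    rw [hfl]

end SmoothPaths

/-! ### Dominated convergence in `L²` -/

/-- Dominated convergence in `L²`. -/
lemma tendsto_Lp_two_of_dominated {α E ι : Type*} [MeasurableSpace α] {μ : Measure α}
    [NormedAddCommGroup E] {l : Filter ι} [l.IsCountablyGenerated] {U : ι → Lp E 2 μ}
    {U₀ : Lp E 2 μ} {V : ι → α → E} {V₀ : α → E} {g : α → ℝ} (hg : MemLp g 2 μ)
    (hUV : ∀ i, U i =ᵐ[μ] V i) (hU₀ : U₀ =ᵐ[μ] V₀) (hV : ∀ i, ∀ᵐ z ∂μ, ‖V i z‖ ≤ g z)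
    (hV₀ : ∀ᵐ z ∂μ, ‖V₀ z‖ ≤ g z)
    (hlim : ∀ᵐ z ∂μ, Filter.Tendsto (fun i => V i z) l (𝓝 (V₀ z))) :
    Filter.Tendsto U l (𝓝 U₀) := by
  have hN : ∀ h : Lp E 2 μ, ‖h‖ = √(∫ t, ‖h t‖ ^ 2 ∂μ) := by
    intro h
    rw [Lp.norm_def, MemLp.eLpNorm_eq_integral_rpow_norm (by norm_num) (by norm_num) (Lp.memLp h),
      ENNReal.toReal_ofReal (by positivity)]
    simp only [ENNReal.toReal_ofNat, Real.rpow_ofNat]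
    rw [show (2⁻¹ : ℝ) = 1 / 2 by norm_num, ← Real.sqrt_eq_rpow]
  rw [tendsto_iff_norm_sub_tendsto_zero]
  simp only [hN]
  have key : Filter.Tendsto (fun i => ∫ t, ‖(U i - U₀ : Lp E 2 μ) t‖ ^ 2 ∂μ) l
      (𝓝 (∫ _, 0 ∂μ)) := by
    have hae : ∀ i, ∀ᵐ z ∂μ, (U i - U₀ : Lp E 2 μ) z = V i z - V₀ z := by
      intro i
      filter_upwards [Lp.coeFn_sub (U i) U₀, hUV i, hU₀] with z h1 h2 h3
      rw [h1, Pi.sub_apply, h2, h3]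
    have hcongr : ∀ i, ∫ t, ‖(U i - U₀ : Lp E 2 μ) t‖ ^ 2 ∂μ = ∫ t, ‖V i t - V₀ t‖ ^ 2 ∂μ := by
      intro i
      refine integral_congr_ae ?_
      filter_upwards [hae i] with z hz
      rw [hz]
    simp only [hcongr]
    refine tendsto_integral_filter_of_dominated_convergence (fun z => (2 * g z) ^ 2)
      (Filter.Eventually.of_forall fun i => ?_) (Filter.Eventually.of_forall fun i => ?_) ?_ ?_
    · exact ((((Lp.aestronglyMeasurable (U i)).congr (hUV i)).sub
        ((Lp.aestronglyMeasurable U₀).congr hU₀)).norm.pow 2)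
    · filter_upwards [hV i, hV₀] with z h1 h2
      rw [norm_pow, norm_norm]
      gcongr
      exact (norm_sub_le _ _).trans (by linarith)
    · exact (hg.const_mul 2).integrable_sq
    · filter_upwards [hlim] with z hz
      simpa using ((hz.sub_const (V₀ z)).norm).pow 2
  simpa using key.sqrt

/-! ### The coordinate of the circle -/

/-- The representative in `[0, 1)` of a point of `ℝ / ℤ`. -/
noncomputable def circleCoord (z : S1) : ℝ := AddCircle.equivIco 1 0 z

lemma circleCoord_nonneg (z : S1) : 0 ≤ circleCoord z := (AddCircle.equivIco 1 0 z).2.1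

lemma circleCoord_lt_one (z : S1) : circleCoord z < 1 := by
  have h : circleCoord z < 0 + 1 := (AddCircle.equivIco 1 0 z).2.2
  rwa [zero_add] at h

lemma coe_circleCoord (z : S1) : ((circleCoord z : ℝ) : S1) = z := AddCircle.coe_equivIco

lemma circleCoord_injective : Function.Injective circleCoord :=
  Function.LeftInverse.injective coe_circleCoord

lemma measurable_circleCoord : Measurable circleCoord :=
  measurable_subtype_coe.comp (AddCircle.measurableEquivIco 1 0).measurable

lemma continuousAt_circleCoord {z : S1} (hz : z ≠ 0) : ContinuousAt circleCoord z :=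
  continuousAt_subtype_val.comp (AddCircle.continuousAt_equivIco 1 0 (by simpa using hz))

instance : NullSingletonClass circleMeasure where
  measure_singleton z := by
    have h : (volume : Measure S1) = circleMeasure := by
      rw [AddCircle.volume_eq_smul_haarAddCircle, ENNReal.ofReal_one, one_smul]
    rw [← h, ← Metric.closedBall_zero, AddCircle.volume_closedBall]
    simp

lemma ae_circleCoord_notMem {s : Set ℝ} (hs : s.Countable) :
    ∀ᵐ z ∂circleMeasure, circleCoord z ∉ s :=
  (hs.preimage circleCoord_injective).ae_notMem circleMeasure

lemma ae_circleCoord_ne (s : ℝ) : ∀ᵐ z ∂circleMeasure, circleCoord z ≠ s := by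
  simpa only [Set.mem_singleton_iff] using ae_circleCoord_notMem (Set.countable_singleton s)

/-! ### Functions in the closure of the smooth loops -/

section Loops

variable {m d : ℕ} {N : Type*} [TopologicalSpace N] [ChartedSpace (EuclideanSpace ℝ (Fin d)) N]

lemma IsSmoothLoop.continuous {f : S1 → N} (hf : IsSmoothLoop d f) : Continuous f :=
  isQuotientMap_quotient_mk'.continuous_iff.2 (ContMDiff.continuous hf)

/-- The circle has finite measure, so a constant dominates in $L^2$, and the closure of the smooth
loops is closed. -/
lemma mem_l2Loops_of_tendsto {e : N → MatC m} {V : ℕ → S1 → MatC m} {C : ℝ}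
    (hV : ∀ n, AEStronglyMeasurable (V n) circleMeasure)
    (hmem : ∀ n, ∀ U : L2Circle m, U =ᵐ[circleMeasure] V n → U ∈ l2Loops d e)
    (hC : ∀ n z, ‖V n z‖ ≤ C) {V₀ : S1 → MatC m} (hC₀ : ∀ z, ‖V₀ z‖ ≤ C)
    (hlim : ∀ᵐ z ∂circleMeasure, Filter.Tendsto (fun n => V n z) Filter.atTop (𝓝 (V₀ z)))
    {U : L2Circle m} (hU : U =ᵐ[circleMeasure] V₀) : U ∈ l2Loops d e := by
  have hL : ∀ n, MemLp (V n) 2 circleMeasure := fun n =>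
    MemLp.of_bound (hV n) C (Filter.Eventually.of_forall (hC n))
  refine isClosed_closure.mem_of_tendsto (tendsto_Lp_two_of_dominated (memLp_const C)
    (fun n => (hL n).coeFn_toLp) hU (fun n => Filter.Eventually.of_forall (hC n))
    (Filter.Eventually.of_forall hC₀) hlim) (Filter.Eventually.of_forall fun n => ?_)
  exact hmem n _ (hL n).coeFn_toLp

/-- Periodic step functions with values in `N` are limits of smooth loops. -/
lemma mem_l2Loops_of_step [IsManifold (𝓡 d) ∞ N] [ConnectedSpace N] {e : N → MatC m}
    (he : Continuous e) {n : ℕ} (hn : 0 < n) {x : ℤ → N} (hx : ∀ j, x (j + n) = x j)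
    {U : L2Circle m} (hU : U =ᵐ[circleMeasure] fun z => e (x ⌊n * circleCoord z⌋)) :
    U ∈ l2Loops d e := by
  choose P hP using fun x y : N => exists_isSmoothPath (d := d) x y
  set c : ℤ → ℝ → N := fun j => P (x (j - 1)) (x j)
  have hc : ∀ j, IsSmoothPath d (x (j - 1)) (x j) (c j) := fun j => hP _ _
  have hper : ∀ j, c (j + n) = c j := fun j => by
    simp only [c, hx, show j + n - 1 = j - 1 + n by ring]
  -- The loop `f K` moves from `x (j - 1)` to `x j` at the start of the interval $j$ and then rests;
  -- the shift by $2$ makes it smooth for every $K$.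
  set f : ℕ → S1 → N := fun K => (periodic_pathChain n ((K : ℝ) + 2) hper).lift
  have hf : ∀ K (t : ℝ), f K (t : S1) = pathChain n ((K : ℝ) + 2) c t := fun K t => rfl
  have hfs : ∀ K, IsSmoothLoop d (f K) := fun K =>
    contMDiff_pathChain (by linarith [K.cast_nonneg (α := ℝ)]) hc
  -- All the loops run in this compact set, whatever their speed, which gives a bound independent of
  -- $K$.
  have hcpt : IsCompact (⋃ j ∈ Set.Icc (0 : ℤ) n, Set.range (c j)) :=
    (Set.finite_Icc (0 : ℤ) n).isCompact_biUnion fun j _ => (hc j).isCompact_range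
  have hfloor : ∀ z, ⌊n * circleCoord z⌋ ∈ Set.Icc (0 : ℤ) n := fun z =>
    ⟨Int.floor_nonneg.2 (mul_nonneg n.cast_nonneg (circleCoord_nonneg z)),
      Int.floor_le_iff.2 (by
        push_cast
        nlinarith [circleCoord_lt_one z, n.cast_nonneg (α := ℝ)])⟩
  obtain ⟨C, hC⟩ := (hcpt.image he).isBounded.exists_norm_le
  have hbound : ∀ z t, ‖e (c ⌊n * circleCoord z⌋ t)‖ ≤ C := fun z t =>
    hC _ ⟨_, Set.mem_biUnion (hfloor z) ⟨t, rfl⟩, rfl⟩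
  refine mem_l2Loops_of_tendsto (V := fun K => e ∘ f K) (C := C)
    (fun K => (he.comp (hfs K).continuous).aestronglyMeasurable)
    (fun K U hU => subset_closure ⟨f K, hfs K, hU⟩) (fun K z => ?_) (fun z => ?_) ?_ hU
  · rw [Function.comp_apply, ← coe_circleCoord z, hf]
    exact hbound _ _
  · simpa only [(hc _).eq_right 1 le_rfl] using hbound z 1
  -- Away from the countably many points $j/n$ the fractional part is positive, so the transition is
  -- over once $K$ is large and the values are eventually constant.
  · filter_upwards [ae_circleCoord_notMem 
      (Set.countable_range fun j : ℤ => (j : ℝ) / n)] with z hz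
    have hpos : 0 < Int.fract (n * circleCoord z) := by
      refine (Int.fract_nonneg _).lt_of_ne' fun h => hz ⟨⌊n * circleCoord z⌋, ?_⟩
      dsimp only
      have := Int.floor_add_fract (n * circleCoord z)
      rw [h, add_zero] at this
      rw [this]
      field_simp
    obtain ⟨K₀, hK₀⟩ := exists_nat_gt (1 / Int.fract (n * circleCoord z))
    refine tendsto_const_nhds.congr' ?_
    filter_upwards [Filter.eventually_ge_atTop K₀] with K hK
    have hK' : (K₀ : ℝ) ≤ K := by exact_mod_cast hK
    rw [Function.comp_apply]
    conv_rhs => rw [← coe_circleCoord z, hf, pathChain]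
    rw [(hc _).eq_right]
    rw [div_lt_iff₀ hpos] at hK₀
    nlinarith

/-- Bounded almost everywhere continuous functions with values in `N` are limits of smooth
loops. -/
lemma mem_l2Loops_of_ae_continuousAt [IsManifold (𝓡 d) ∞ N] [ConnectedSpace N] {e : N → MatC m}
    (he : Continuous e) {u : S1 → N} {C : ℝ} (hC : ∀ z, ‖e (u z)‖ ≤ C)
    (hu : ∀ᵐ z ∂circleMeasure, ContinuousAt (e ∘ u) z)
    {U : L2Circle m} (hU : U =ᵐ[circleMeasure] e ∘ u) : U ∈ l2Loops d e := by
  -- Sampling at the left ends of $n+1$ equal intervals; the sample points converge to $z$, so the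
  -- values converge wherever $e \circ u$ is continuous.
  set x : ℕ → ℤ → N := fun n j => u (((j : ℝ) / ((n + 1 : ℕ) : ℝ) : ℝ) : S1)
  have hx : ∀ n j, x n (j + (n + 1 : ℕ)) = x n j := by
    intro n j
    have h : ((j + (n + 1 : ℕ) : ℤ) : ℝ) / ((n + 1 : ℕ) : ℝ) = j / ((n + 1 : ℕ) : ℝ) + 1 := by
      push_cast
      field_simp
    simp only [x]
    rw [h, AddCircle.coe_add_period]
  refine mem_l2Loops_of_tendsto (V := fun n z => e (x n ⌊((n + 1 : ℕ) : ℝ) * circleCoord z⌋))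
    (C := C) (fun n => ?_) (fun n U hU => mem_l2Loops_of_step he n.succ_pos (hx n) hU)
    (fun n z => hC _) hC ?_ hU
  · exact ((StronglyMeasurable.of_discrete (f := fun j : ℤ => e (x n j))).comp_measurable
      (Int.measurable_floor.comp (measurable_circleCoord.const_mul _))).aestronglyMeasurable
  · filter_upwards [hu] with z hz
    have hlim : Filter.Tendsto (fun n : ℕ =>
        (⌊((n + 1 : ℕ) : ℝ) * circleCoord z⌋ : ℝ) / ((n + 1 : ℕ) : ℝ))
        Filter.atTop (𝓝 (circleCoord z)) := by
      refine Filter.Tendsto.congr (fun n => ?_) (((tendsto_nat_floor_mul_div_atTop (circleCoord_nonneg z)).comp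
        tendsto_natCast_atTop_atTop).comp (Filter.tendsto_add_atTop_nat 1))
      simp only [Function.comp_apply]
      rw [mul_comm, natCast_floor_eq_intCast_floor
        (mul_nonneg (Nat.cast_nonneg _) (circleCoord_nonneg z))]
    have h2 : Filter.Tendsto (fun t : ℝ => (t : S1)) (𝓝 (circleCoord z)) (𝓝 z) := by
      have := (AddCircle.continuous_mk' (1 : ℝ)).tendsto (circleCoord z)
      rwa [show (QuotientAddGroup.mk' (AddSubgroup.zmultiples (1 : ℝ)) (circleCoord z) : S1) = z
        from coe_circleCoord z] at this
    exact (hz.tendsto.comp h2).comp hlim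

end Loops

/-! ### Splicing of loops -/

section Splice

variable {m : ℕ}

lemma measurableSet_circleCoord_lt (s : ℝ) : MeasurableSet {z : S1 | circleCoord z < s} :=
  measurable_circleCoord measurableSet_Iio

/-- The restriction of `w ∈ L²(S¹, M)` to `[0, s)`, extended by zero. -/
noncomputable def cutoff (s : ℝ) (w : L2Circle m) : L2Circle m :=
  ((Lp.memLp w).indicator (measurableSet_circleCoord_lt s)).toLp

lemma coeFn_cutoff (s : ℝ) (w : L2Circle m) :
    cutoff s w =ᵐ[circleMeasure] {z : S1 | circleCoord z < s}.indicator w :=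
  MemLp.coeFn_toLp _

lemma lipschitzWith_cutoff (s : ℝ) : LipschitzWith 1 (cutoff s : L2Circle m → L2Circle m) := by
  refine LipschitzWith.of_dist_le_mul fun w w' => ?_
  rw [NNReal.coe_one, one_mul, dist_eq_norm, dist_eq_norm]
  refine Lp.norm_le_norm_of_ae_le ?_
  filter_upwards [coeFn_cutoff s w, coeFn_cutoff s w', Lp.coeFn_sub w w',
    Lp.coeFn_sub (cutoff s w) (cutoff s w')] with z h1 h2 h3 h4
  rw [h3, h4, Pi.sub_apply, Pi.sub_apply, h1, h2]
  by_cases hz : circleCoord z < s <;> simp [Set.indicator, hz]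

/-- Off the null set where the coordinate equals $s$, the indicators are eventually constant as $r
\to s$, and $\|w\|$ dominates. -/
lemma continuous_cutoff_left (w : L2Circle m) : Continuous fun s => cutoff s w := by
  refine continuous_iff_continuousAt.2 fun s => ?_
  have hle : ∀ r z, ‖{z : S1 | circleCoord z < r}.indicator w z‖ ≤ ‖w z‖ := fun r z =>
    norm_indicator_le_norm_self _ _
  refine tendsto_Lp_two_of_dominated (Lp.memLp w).norm (fun r => coeFn_cutoff r w)
    (coeFn_cutoff s w) (fun r => Filter.Eventually.of_forall (hle r))
    (Filter.Eventually.of_forall (hle s)) ?_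
  filter_upwards [ae_circleCoord_ne s] with z hz
  refine tendsto_const_nhds.congr' ?_
  rcases hz.lt_or_gt with h | h
  · filter_upwards [Ioi_mem_nhds h] with r hr
    rw [Set.indicator_of_mem (show z ∈ {z | circleCoord z < r} from hr),
      Set.indicator_of_mem (show z ∈ {z | circleCoord z < s} from h)]
  · filter_upwards [Iio_mem_nhds h] with r hr
    rw [Set.indicator_of_notMem (show z ∉ {z | circleCoord z < r} from not_lt.2 (Set.mem_Iio.1 hr).le),
      Set.indicator_of_notMem (show z ∉ {z | circleCoord z < s} from not_lt.2 h.le)]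

lemma continuous_cutoff : Continuous fun p : ℝ × L2Circle m => cutoff p.1 p.2 :=
  continuous_prod_of_continuous_lipschitzWith' _ 1 lipschitzWith_cutoff continuous_cutoff_left

/-- The function equal to `u` on `[0, s)` and to `v` on `[s, 1)`. -/
noncomputable def splice (s : ℝ) (u v : L2Circle m) : L2Circle m := v + cutoff s (u - v)

lemma continuous_splice :
    Continuous fun p : ℝ × L2Circle m × L2Circle m => splice p.1 p.2.1 p.2.2 :=
  continuous_snd.snd.add (continuous_cutoff.comp
    (continuous_fst.prodMk (continuous_snd.fst.sub continuous_snd.snd)))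

lemma coeFn_splice (s : ℝ) (u v : L2Circle m) :
    splice s u v =ᵐ[circleMeasure] fun z => if circleCoord z < s then u z else v z := by
  filter_upwards [Lp.coeFn_add v (cutoff s (u - v)), coeFn_cutoff s (u - v), Lp.coeFn_sub u v]
    with z h1 h2 h3
  rw [splice, h1, Pi.add_apply, h2]
  by_cases hz : circleCoord z < s
  · rw [Set.indicator_of_mem (show z ∈ {z | circleCoord z < s} from hz), h3, if_pos hz]
    exact add_sub_cancel _ _
  · rw [Set.indicator_of_notMem (show z ∉ {z | circleCoord z < s} from hz), if_neg hz, add_zero]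

lemma splice_zero (u v : L2Circle m) : splice 0 u v = v := by
  refine Lp.ext ?_
  filter_upwards [coeFn_splice 0 u v] with z hz
  rw [hz, if_neg (not_lt.2 (circleCoord_nonneg z))]

lemma splice_one (u v : L2Circle m) : splice 1 u v = u := by
  refine Lp.ext ?_
  filter_upwards [coeFn_splice 1 u v] with z hz
  rw [hz, if_pos (circleCoord_lt_one z)]

lemma splice_self (s : ℝ) (u : L2Circle m) : splice s u u = u := by
  refine Lp.ext ?_
  filter_upwards [coeFn_splice s u u] with z hz
  rw [hz, ite_self]

variable {d : ℕ} {N : Type*} [TopologicalSpace N] [ChartedSpace (EuclideanSpace ℝ (Fin d)) N]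
  [IsManifold (𝓡 d) ∞ N] [ConnectedSpace N]

/-- Discontinuities can occur only at coordinate $s$ and at $0$, where the coordinate itself jumps.
-/
lemma splice_mem_l2Loops_of_isSmoothLoop {e : N → MatC m} (he : Continuous e) {f g : S1 → N}
    (hf : IsSmoothLoop d f) (hg : IsSmoothLoop d g) {u v : L2Circle m}
    (hu : u =ᵐ[circleMeasure] e ∘ f) (hv : v =ᵐ[circleMeasure] e ∘ g) (s : ℝ) :
    splice s u v ∈ l2Loops d e := by
  have hef : Continuous (e ∘ f) := he.comp hf.continuous
  have heg : Continuous (e ∘ g) := he.comp hg.continuous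
  obtain ⟨C, hC⟩ := (isCompact_range hef).isBounded.exists_norm_le
  obtain ⟨C', hC'⟩ := (isCompact_range heg).isBounded.exists_norm_le
  refine mem_l2Loops_of_ae_continuousAt he (u := fun z => if circleCoord z < s then f z else g z)
    (C := max C C') (fun z => ?_) ?_ ?_
  · split_ifs
    · exact (hC _ ⟨z, rfl⟩).trans (le_max_left _ _)
    · exact (hC' _ ⟨z, rfl⟩).trans (le_max_right _ _)
  · filter_upwards [ae_circleCoord_ne s, measure_eq_zero_iff_ae_notMem.1
      (measure_singleton (μ := circleMeasure) 0)] with z hz hz0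
    have hcont := continuousAt_circleCoord (z := z) (by simpa using hz0)
    rcases hz.lt_or_gt with h | h
    · refine hef.continuousAt.congr ?_
      filter_upwards [hcont.preimage_mem_nhds (Iio_mem_nhds h)] with y hy
      simp only [Function.comp_apply]
      rw [if_pos (show circleCoord y < s from hy)]
    · refine heg.continuousAt.congr ?_
      filter_upwards [hcont.preimage_mem_nhds (Ioi_mem_nhds h)] with y hy
      simp only [Function.comp_apply]
      rw [if_neg (not_lt.2 (le_of_lt (show s < circleCoord y from hy)))]
  · filter_upwards [coeFn_splice s u v, hu, hv] with z h1 h2 h3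
    rw [h1, h2, h3, Function.comp_apply, Function.comp_apply, Function.comp_apply]
    split_ifs <;> rfl

lemma splice_mem_l2Loops {e : N → MatC m} (he : Continuous e) {u v : L2Circle m}
    (hu : u ∈ l2Loops d e) (hv : v ∈ l2Loops d e) (s : ℝ) : splice s u v ∈ l2Loops d e := by
  have h : Continuous (Function.uncurry (splice (m := m) s)) :=
    continuous_splice.comp (continuous_const.prodMk continuous_id)
  have := map_mem_closure₂ h hu hv
    (fun _ ⟨_, hf, hu⟩ _ ⟨_, hg, hv⟩ => splice_mem_l2Loops_of_isSmoothLoop he hf hg hu hv s)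
  rwa [l2Loops, closure_closure] at this

/-- The contraction of `L²(S¹, N)` onto any of its points, which stays fixed. -/
noncomputable def l2LoopsContraction {e : N → MatC m} (he : Continuous e) (v : l2Loops d e) :
    (ContinuousMap.id (l2Loops d e)).HomotopyRel (ContinuousMap.const _ v) {v} where
  -- Time is reversed because `splice 1` returns the moving loop and `splice 0` the centre.
  toFun p := ⟨splice (1 - p.1) p.2.1 v.1, splice_mem_l2Loops he p.2.2 v.2 _⟩
  continuous_toFun := (continuous_splice.comp (Continuous.prodMk
    (continuous_const.sub (continuous_subtype_val.comp continuous_fst))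
    ((continuous_subtype_val.comp continuous_snd).prodMk continuous_const))).subtype_mk _
  map_zero_left u := Subtype.ext (by simpa using splice_one u.1 v.1)
  map_one_left u := Subtype.ext (by simpa using splice_zero u.1 v.1)
  prop' t u hu := by
    obtain rfl : u = v := hu
    exact Subtype.ext (splice_self _ _)

end Splice

/-! ### Maps homotopic to a constant map -/

section Nullhomotopic

variable (A : AddCommGrpCat.{0}) (n : ℕ) {X Y : Type} [TopologicalSpace X] [TopologicalSpace Y]
  {f : C(X, Y)} {y : Y}

/-- Homotopy invariance, together with the factorisation of a constant map through the point. -/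
lemma singularH_map_eq_of_homotopy_const (H : f.Homotopy (ContinuousMap.const X y)) :
    (singularH A n).map (TopCat.ofHom f) = (singularH A n).map (toPoint (TopCat.of X)) ≫
      (singularH A n).map (TopCat.ofHom (ContinuousMap.const PUnit.{1} y)) := by
  rw [← Functor.map_comp]
  exact TopCat.Homotopy.congr_homologyMap_singularChainComplexFunctor
    (f := TopCat.ofHom f) (g := TopCat.ofHom (ContinuousMap.const X y)) H A n

/-- A nullhomotopic map is zero on homology in positive degrees. -/
lemma singularH_map_eq_zero (hn : n ≠ 0) (H : f.Homotopy (ContinuousMap.const X y)) :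
    (singularH A n).map (TopCat.ofHom f) = 0 := by
  have h0 : (singularH A n).map (toPoint (TopCat.of X)) = 0 :=
    (AlgebraicTopology.isZero_singularHomologyFunctor_of_totallyDisconnectedSpace
      AddCommGrpCat.{0} n A (TopCat.of PUnit.{1}) hn).eq_zero_of_tgt _
  rw [singularH_map_eq_of_homotopy_const A n H, h0, Limits.zero_comp]

/-- A nullhomotopic map is zero on reduced homology. -/
lemma reducedSingularHMap_eq_zero (H : f.Homotopy (ContinuousMap.const X y)) :
    reducedSingularHMap A n (TopCat.ofHom f) = 0 := by
  -- After the inclusion of the kernel the map factors through $H_n(\mathrm{pt})$, where reduced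
  -- classes vanish by definition.
  refine (cancel_mono (Limits.kernel.ι ((singularH A n).map (toPoint (TopCat.of Y))))).1 ?_
  refine (Limits.kernel.lift_ι _ _ _).trans (Eq.trans ?_ Limits.zero_comp.symm)
  rw [singularH_map_eq_of_homotopy_const A n H, Limits.kernel.condition_assoc, Limits.zero_comp]
  rfl

end Nullhomotopic

/-- A map homotopic to a constant map, relative to a point, is trivial on the homotopy groups
based at this point. -/
lemma homotopyGroupMap_eq_base {X Y : Type*} [TopologicalSpace X] [TopologicalSpace Y] (n : ℕ)
    (f : C(X, Y)) (x : X) (H : f.HomotopyRel (ContinuousMap.const X (f x)) {x}) (a : π_ n X x) :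
    homotopyGroupMap n f x a = homotopyGroupBase n (f x) := by
  induction a using Quotient.inductionOn with
  | h p =>
    refine Quotient.sound ⟨⟨H.toHomotopy.comp (.refl p.1), fun t y hy => ?_⟩⟩
    -- The boundary of the cube goes to $x$, where the homotopy is stationary.
    have hp : p.1 y = x := p.2 y hy
    change H (t, p.1 y) = f (p.1 y)
    rw [hp]
    exact H.eq_fst t rfl

theorem mainTheorem4 (m d : ℕ) {N : Type*} [TopologicalSpace N]
    [ChartedSpace (EuclideanSpace ℝ (Fin d)) N] [IsManifold (𝓡 d) ∞ N] [ConnectedSpace N]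
    (e : N → MatC m) (he : Manifold.IsSmoothEmbedding (𝓡 d) 𝓘(ℝ, MatC m) ∞ e)
    (x₀ : N) (k : ℝ) (hk : 1 / 2 < k) :
    -- zero on reduced homology in every degree, and on homology in every positive degree
    (∀ (A : AddCommGrpCat.{0}) (n : ℕ),
      reducedSingularHMap A n (TopCat.ofHom (loopInclusion d hk e x₀)) = 0) ∧
    (∀ (A : AddCommGrpCat.{0}) (n : ℕ), 1 ≤ n →
      (singularH A n).map (TopCat.ofHom (loopInclusion d hk e x₀)) = 0) ∧
    -- trivial on homotopy groups, for every base point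
    (∀ (n : ℕ) (γ : basedSobolevLoops d k e x₀) (a : π_ n (basedSobolevLoops d k e x₀) γ),
      homotopyGroupMap n (loopInclusion d hk e x₀) γ a =
        homotopyGroupBase n (loopInclusion d hk e x₀ γ)) := by
  have hcont : Continuous e := he.isEmbedding.continuous
  have hc : IsSmoothLoop d fun _ : S1 => x₀ := contMDiff_const
  -- For homology the homotopy is free, so any centre serves; for $\pi_n$ the centre below is the
  -- image of $\gamma$, so that the base point stays fixed.
  let v : l2Loops d e := ⟨Lp.const 2 circleMeasure (e x₀),
    subset_closure ⟨_, hc, Lp.coeFn_const _ _ _⟩⟩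
  have H : (loopInclusion d hk e x₀).Homotopy (ContinuousMap.const _ v) :=
    (l2LoopsContraction hcont v).toHomotopy.comp (.refl (loopInclusion d hk e x₀))
  exact ⟨fun A n => reducedSingularHMap_eq_zero A n H,
    fun A n hn => singularH_map_eq_zero A n (Nat.one_le_iff_ne_zero.1 hn) H,
    fun n γ a => homotopyGroupMap_eq_base n (loopInclusion d hk e x₀) γ
      ⟨(l2LoopsContraction hcont (loopInclusion d hk e x₀ γ)).toHomotopy.comp
        (.refl (loopInclusion d hk e x₀)), fun t u hu =>
        (l2LoopsContraction hcont (loopInclusion d hk e x₀ γ)).eq_fst t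
          (congrArg (loopInclusion d hk e x₀) (Set.mem_singleton_iff.1 hu))⟩ a⟩
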